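/- Let $0<\sigma<\infty$. For $f\in L^1(\mathbb R)$ (complex valued) put $\hat f(t)=\int_{\mathbb R}f(x)e^{-itx}\,dx$, and for a finite complex Borel measure $\mu$ on $\mathbb R$ put $\hat\mu(t)=\int_{\mathbb R}e^{-itx}\,d\mu(x)$. Let $B^1_\sigma=\{f\in L^1(\mathbb R):\hat f=0\text{ outside }[-\sigma,\sigma]\}$ be the Bernstein space with the norm of $L^1(\mathbb R)$, and let $D(B^1_\sigma)$ be its closed unit ball. The space $B^1_\sigma$ is the dual of $C_0(\mathbb R)/C_{0,\sigma}(\mathbb R)$ through the pairing $\langle f,[u]\rangle=\int_{\mathbb R}u f\,dx$, where $C_{0,\sigma}(\mathbb R)$ is the set of all $u\in C_0(\mathbb R)$ such that $\int_{\mathbb R} u\,d\mu=0$ for every finite complex Borel measure $\mu$ with $\hat\mu(t)=0$ for all $|t|\ge\sigma$; the weak* topology of $B^1_\sigma$ is the one defined by this duality. A continuous linear functional $\Phi$ on $B^1_\sigma$ is an exposing functional for $f\in D(B^1_\sigma)$ if $\Phi(f)=\|\Phi\|=1$ and $\operatorname{Re}\Phi(g)<1$ for all $g\in D(B^1_\sigma)$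 with $g\neq f$. A function $f\in D(B^1_\sigma)$ is called - strongly exposed, if it has an exposing functional $\Phi$ such that $f_n\to f$ in $B^1_\sigma$ for every sequence $(f_n)$ in $D(B^1_\sigma)$ with $\Phi(f_n)\to 1$; the set of these functions is $\operatorname{exps}D(B^1_\sigma)$; - weak* exposed, if it has a weak* continuous exposing functional; the set of these functions is $\operatorname{exp}^*D(B^1_\sigma)$; - weak* strongly exposed, if it is both weak* exposed and strongly exposed, so that their set is $\operatorname{exps}^*D(B^1_\sigma)=\operatorname{exp}^*D(B^1_\sigma)\cap\operatorname{exps}D(B^1_\sigma)$. **Theorem.** Every weak* exposed function in $D(B^1_\sigma)$ is weak* strongly exposed, that is, $$\operatorname{exp}^*D(B^1_\sigma)=\operatorname{exps}^*D(B^1_\sigma).$$ -/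

import Mathlib

open MeasureTheory Filter Topology
open scoped ZeroAtInfty ENNReal

noncomputable section

namespace BernsteinSpace

/-! ### The space `B¹_σ` -/

/-- The Fourier transform `∫ f(x) e^{-itx} dx` of an integrable function on the line,
in the angular frequency `t`. -/
def fourierL1 (f : ℝ → ℂ) (t : ℝ) : ℂ :=
  ∫ x : ℝ, Complex.exp (-((t * x : ℝ) : ℂ) * Complex.I) * f x

lemma norm_expKernel (t x : ℝ) : ‖Complex.exp (-((t * x : ℝ) : ℂ) * Complex.I)‖ = 1 := by
  rw [← Complex.ofReal_neg, Complex.norm_exp_ofReal_mul_I]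

lemma continuous_expKernel (t : ℝ) :
    Continuous fun x : ℝ => Complex.exp (-((t * x : ℝ) : ℂ) * Complex.I) := by
  fun_prop

lemma integrable_bounded_mul {f h : ℝ → ℂ} (hf : Integrable f) (hh : Continuous h) (C : ℝ)
    (hC : ∀ x, ‖h x‖ ≤ C) : Integrable fun x => h x * f x :=
  hf.bdd_mul hh.aestronglyMeasurable (Eventually.of_forall hC)

lemma integrable_exp_mul {f : ℝ → ℂ} (hf : Integrable f) (t : ℝ) :
    Integrable fun x : ℝ => Complex.exp (-((t * x : ℝ) : ℂ) * Complex.I) * f x :=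
  integrable_bounded_mul hf (continuous_expKernel t) 1 fun x => (norm_expKernel t x).le

lemma fourierL1_continuous {f : ℝ → ℂ} (hf : Integrable f) : Continuous (fourierL1 f) := by
  refine continuous_of_dominated (bound := fun x => ‖f x‖)
    (fun t => (integrable_exp_mul hf t).aestronglyMeasurable)
    (fun t => Eventually.of_forall fun x => ?_) hf.norm (Eventually.of_forall fun x => ?_)
  · rw [norm_mul, norm_expKernel, one_mul]
  · fun_prop

/-- The Bernstein space `B¹_σ`: the integrable functions (classes in `L¹(ℝ)`) whose Fourier
transform vanishes outside `[-σ, σ]`. It carries the norm of `L¹(ℝ)`. -/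
def B (σ : ℝ) : Submodule ℂ (Lp ℂ 1 (volume : Measure ℝ)) where
  carrier := {f | ∀ t : ℝ, t ∉ Set.Icc (-σ) σ → fourierL1 f t = 0}
  zero_mem' := fun t _ => by
    have : fourierL1 (((0 : Lp ℂ 1 (volume : Measure ℝ))) : ℝ → ℂ) t = ∫ _ : ℝ, (0 : ℂ) := by
      refine integral_congr_ae ?_
      filter_upwards [Lp.coeFn_zero ℂ 1 (volume : Measure ℝ)] with x hx
      rw [hx, Pi.zero_apply, mul_zero]
    simpa using this
  add_mem' := fun {f g} hf hg t ht => by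
    have : fourierL1 ((f + g : Lp ℂ 1 (volume : Measure ℝ)) : ℝ → ℂ) t =
        fourierL1 f t + fourierL1 g t := by
      unfold fourierL1
      rw [← integral_add (integrable_exp_mul (L1.integrable_coeFn f) t)
        (integrable_exp_mul (L1.integrable_coeFn g) t)]
      refine integral_congr_ae ?_
      filter_upwards [Lp.coeFn_add f g] with x hx
      rw [hx, Pi.add_apply, mul_add]
    rw [this, hf t ht, hg t ht, add_zero]
  smul_mem' := fun c f hf t ht => by
    have : fourierL1 ((c • f : Lp ℂ 1 (volume : Measure ℝ)) : ℝ → ℂ) t =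
        c * fourierL1 f t := by
      unfold fourierL1
      rw [← integral_const_mul]
      refine integral_congr_ae ?_
      filter_upwards [Lp.coeFn_smul c f] with x hx
      simp only [hx, Pi.smul_apply, smul_eq_mul]
      ring
    rw [this, hf t ht, mul_zero]

/-- The underlying function of an element of `B¹_σ`, defined up to equality almost everywhere. -/
def toFun {σ : ℝ} (f : B σ) : ℝ → ℂ := ((f : Lp ℂ 1 (volume : Measure ℝ)) : ℝ → ℂ)

lemma integrable_toFun {σ : ℝ} (f : B σ) : Integrable (toFun f) := L1.integrable_coeFn _

/-- The closed unit ball `D(B¹_σ)`. -/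
def D (σ : ℝ) : Set (B σ) := Metric.closedBall 0 1

/-! ### The predual `C₀(ℝ) / C_{0,σ}(ℝ)` -/

/-- The integral `∫ u dμ` against a finite complex Borel measure on the line. -/
def cintegral (μ : ComplexMeasure ℝ) (u : ℝ → ℂ) : ℂ :=
  VectorMeasure.integral μ u (ContinuousLinearMap.mul ℝ ℂ)

/-- The Fourier–Stieltjes transform `∫ e^{-itx} dμ(x)`. -/
def fourierStieltjes (μ : ComplexMeasure ℝ) (t : ℝ) : ℂ :=
  cintegral μ fun x => Complex.exp (-((t * x : ℝ) : ℂ) * Complex.I)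

/-- The ideal of the finite complex Borel measures whose Fourier–Stieltjes transform vanishes
for `|t| ≥ σ`. -/
def bandIdeal (σ : ℝ) : Set (ComplexMeasure ℝ) :=
  {μ | ∀ t : ℝ, σ ≤ |t| → fourierStieltjes μ t = 0}

lemma isFiniteMeasure_variation (μ : ComplexMeasure ℝ) : IsFiniteMeasure μ.variation := by
  have h : μ.variation ≤ (ComplexMeasure.re μ).totalVariation +
      (ComplexMeasure.im μ).totalVariation := by
    refine VectorMeasure.variation_le_of_forall_enorm_le fun E hE => ?_
    have h1 := SignedMeasure.enorm_le_totalVariation (ComplexMeasure.re μ) E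
    have h2 := SignedMeasure.enorm_le_totalVariation (ComplexMeasure.im μ) E
    rw [Measure.add_apply]
    refine le_trans ?_ (add_le_add h1 h2)
    have h3 : μ E = ((ComplexMeasure.re μ E : ℝ) : ℂ) +
        ((ComplexMeasure.im μ E : ℝ) : ℂ) * Complex.I := (Complex.re_add_im (μ E)).symm
    rw [h3]
    refine (enorm_add_le _ _).trans (le_of_eq ?_)
    simp [enorm_eq_nnnorm]
  exact isFiniteMeasure_of_le _ h

lemma integrable_C0 (μ : ComplexMeasure ℝ) (u : C₀(ℝ, ℂ)) : Integrable u μ.variation := by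
  have := isFiniteMeasure_variation μ
  refine Integrable.of_bound (C := ‖u.toBCF‖) u.continuous.aestronglyMeasurable
    (Eventually.of_forall fun x => u.toBCF.norm_coe_le_norm x)

lemma cintegral_add (μ : ComplexMeasure ℝ) {u v : ℝ → ℂ} (hu : Integrable u μ.variation)
    (hv : Integrable v μ.variation) : cintegral μ (u + v) = cintegral μ u + cintegral μ v :=
  VectorMeasure.integral_add hu hv

lemma cintegral_smul (μ : ComplexMeasure ℝ) (c : ℂ) (u : ℝ → ℂ) :
    cintegral μ (c • u) = c * cintegral μ u := by
  unfold cintegral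
  rw [VectorMeasure.integral_eq_setToFun, VectorMeasure.integral_eq_setToFun, ← smul_eq_mul]
  refine setToFun_smul _ (fun c s x => ?_) c u
  rw [transpose_eq_cbmApplyMeasure]
  simp [mul_assoc]

/-- The subspace `C_{0,σ}(ℝ)` of the `u ∈ C₀(ℝ)` annihilated by the ideal `bandIdeal σ`. -/
def C0Sub (σ : ℝ) : Submodule ℂ C₀(ℝ, ℂ) where
  carrier := {u | ∀ μ ∈ bandIdeal σ, cintegral μ u = 0}
  zero_mem' := fun μ _ => VectorMeasure.integral_zero
  add_mem' := fun {u v} hu hv μ hμ => by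
    have := cintegral_add μ (integrable_C0 μ u) (integrable_C0 μ v)
    rw [hu μ hμ, hv μ hμ, add_zero] at this
    exact this
  smul_mem' := fun c u hu μ hμ => by
    have := cintegral_smul μ c u
    rw [hu μ hμ, mul_zero] at this
    exact this

/-- The predual `C₀(ℝ) / C_{0,σ}(ℝ)` of `B¹_σ`. -/
abbrev Predual (σ : ℝ) : Type := C₀(ℝ, ℂ) ⧸ C0Sub σ

/-! ### The duality between `B¹_σ` and its predual -/

lemma integral_mul_eq_withDensity {f : ℝ → ℂ} (hf : Integrable f) (g : ℝ → ℂ) :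
    ∫ x, g x * f x = ∫ x, g x * ((‖f x‖⁻¹ : ℝ) * f x) ∂(volume.withDensity fun x => ‖f x‖ₑ) := by
  rw [integral_withDensity_eq_integral_toReal_smul₀ hf.aestronglyMeasurable.enorm (by simp)]
  refine integral_congr_ae (Eventually.of_forall fun x => ?_)
  by_cases hx : f x = 0
  · simp [hx]
  · have : (‖f x‖ : ℂ) ≠ 0 := by simpa using hx
    simp only [toReal_enorm, Complex.real_smul, Complex.ofReal_inv]
    field_simp

/-- Integration against the complex measure `f dx` is integration of the product with `f`. -/
lemma cintegral_withDensity {f : ℝ → ℂ} (hf : Integrable f) {u : ℝ → ℂ}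
    (hu : Integrable u (volume.withDensity fun x => ‖f x‖ₑ)) :
    cintegral (volume.withDensityᵥ f) u = ∫ x, u x * f x := by
  set ν : Measure ℝ := volume.withDensity fun x => ‖f x‖ₑ with hν
  have hvar : (volume.withDensityᵥ f).variation = ν := Measure.variation_withDensityᵥ hf
  set h : ℝ → ℂ := fun x => (‖f x‖⁻¹ : ℝ) * f x with hh
  have hbd : ∀ x, ‖h x‖ ≤ 1 := fun x => by
    simp only [hh, norm_mul, Complex.norm_real, norm_inv, norm_norm]
    exact inv_mul_le_one
  have hm : AEStronglyMeasurable h ν := by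
    refine AEStronglyMeasurable.mono_ac (withDensity_absolutelyContinuous _ _) ?_
    have h1 := hf.aestronglyMeasurable.norm.inv₀
    exact (Complex.continuous_ofReal.comp_aestronglyMeasurable h1).mul hf.aestronglyMeasurable
  have hint : ∀ {g : ℝ → ℂ}, Integrable g ν → Integrable (fun x => g x * h x) ν := fun hg =>
    hg.mul_bdd hm (Eventually.of_forall hbd)
  rw [integral_mul_eq_withDensity hf]
  change cintegral (volume.withDensityᵥ f) u = ∫ x, u x * h x ∂ν
  refine Integrable.induction
    (P := fun g : ℝ → ℂ => cintegral (volume.withDensityᵥ f) g = ∫ x, g x * h x ∂ν)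
    ?_ ?_ ?_ ?_ hu
  · intro c s hs hsν
    have e1 : cintegral (volume.withDensityᵥ f) (s.indicator fun _ => c) =
        c * volume.withDensityᵥ f s := by
      unfold cintegral
      rw [VectorMeasure.integral_eq_setToFun, setToFun_indicator_const _ hs (by
        rw [hvar]; exact hsν.ne), transpose_eq_cbmApplyMeasure]
      simp
    rw [e1, withDensityᵥ_apply hf hs, ← integral_mul_eq_withDensity hf,
      ← integral_indicator hs, ← integral_const_mul]
    refine integral_congr_ae (Eventually.of_forall fun x => ?_)
    by_cases hx : x ∈ s <;> simp [hx]
  · intro g k _ hg hk hg' hk'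
    rw [cintegral_add _ (hvar ▸ hg) (hvar ▸ hk), hg', hk', ← integral_add (hint hg) (hint hk)]
    simp [add_mul]
  · refine isClosed_eq ?_ ?_
    · unfold cintegral
      simp only [VectorMeasure.integral_eq_setToFun]
      have := continuous_setToFun (dominatedFinMeasAdditive_cbmApplyMeasure
        (volume.withDensityᵥ f) (ContinuousLinearMap.mul ℝ ℂ))
      have key : ∀ (m m' : Measure ℝ) (T : Set ℝ → ℂ →L[ℝ] ℂ) (C : ℝ) (e : m = m')
        (hT : DominatedFinMeasAdditive m T C),
        Continuous fun g : Lp ℂ 1 m' => setToFun m T hT g := by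
          intro m m' T C e hT
          subst e
          exact continuous_setToFun hT
      exact key _ _ _ _ hvar _
    · refine LipschitzWith.continuous (K := 1) (LipschitzWith.of_dist_le_mul fun g k => ?_)
      rw [dist_eq_norm, ← integral_sub (hint (L1.integrable_coeFn g))
        (hint (L1.integrable_coeFn k)), NNReal.coe_one, one_mul, dist_eq_norm,
        L1.norm_eq_integral_norm]
      refine (norm_integral_le_integral_norm _).trans (integral_mono_ae ?_ ?_ ?_)
      · exact ((hint (L1.integrable_coeFn g)).sub (hint (L1.integrable_coeFn k))).norm
      · exact (L1.integrable_coeFn (g - k)).norm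
      · filter_upwards [Lp.coeFn_sub g k] with x hx
        rw [hx, ← sub_mul, norm_mul, Pi.sub_apply]
        exact mul_le_of_le_one_right (norm_nonneg _) (hbd x)
  · intro g k hgk hg hg'
    have e1 : cintegral (volume.withDensityᵥ f) k = cintegral (volume.withDensityᵥ f) g :=
      VectorMeasure.integral_congr_ae (by rw [hvar]; exact hgk.symm)
    rw [e1, hg']
    refine integral_congr_ae ?_
    filter_upwards [hgk] with x hx
    rw [hx]

lemma integrable_withDensity_of_bounded {f : ℝ → ℂ} (hf : Integrable f) {u : ℝ → ℂ}
    (hu : Continuous u) (C : ℝ) (hC : ∀ x, ‖u x‖ ≤ C) :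
    Integrable u (volume.withDensity fun x => ‖f x‖ₑ) := by
  have : IsFiniteMeasure (volume.withDensity fun x => ‖f x‖ₑ) :=
    isFiniteMeasure_withDensity hf.2.ne
  exact Integrable.of_bound hu.aestronglyMeasurable C (Eventually.of_forall hC)

/-- For `f ∈ B¹_σ` the measure `f dx` belongs to `bandIdeal σ`. -/
lemma withDensity_mem_bandIdeal {σ : ℝ} (f : B σ) :
    volume.withDensityᵥ (toFun f) ∈ bandIdeal σ := by
  intro t ht
  have hf := integrable_toFun f
  have e : fourierStieltjes (volume.withDensityᵥ (toFun f)) t = fourierL1 (toFun f) t :=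
    cintegral_withDensity hf (integrable_withDensity_of_bounded hf (continuous_expKernel t) 1
      fun x => (norm_expKernel t x).le)
  rw [e]
  have hcl : IsClosed {s : ℝ | fourierL1 (toFun f) s = 0} :=
    isClosed_eq (fourierL1_continuous hf) continuous_const
  have hv : ∀ s : ℝ, σ < |s| → fourierL1 (toFun f) s = 0 := fun s hs =>
    f.2 s fun h => absurd hs (not_lt.2 (abs_le.2 h))
  rcases le_total 0 t with h0 | h0
  · have hsub : Set.Ioi t ⊆ {s : ℝ | fourierL1 (toFun f) s = 0} := fun s hs =>
      hv s (by
        rw [abs_of_nonneg h0] at ht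
        exact (ht.trans_lt hs).trans_le (le_abs_self s))
    have := closure_minimal hsub hcl
    rw [closure_Ioi] at this
    exact this Set.self_mem_Ici
  · have hsub : Set.Iio t ⊆ {s : ℝ | fourierL1 (toFun f) s = 0} := fun s hs =>
      hv s (by
        rw [abs_of_nonpos h0] at ht
        exact (ht.trans_lt (neg_lt_neg hs)).trans_le (neg_le_abs s))
    have := closure_minimal hsub hcl
    rw [closure_Iio] at this
    exact this Set.self_mem_Iic

lemma integrable_C0_mul {f : ℝ → ℂ} (hf : Integrable f) (u : C₀(ℝ, ℂ)) :
    Integrable fun x => u x * f x :=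
  integrable_bounded_mul hf u.continuous ‖u.toBCF‖ fun x => u.toBCF.norm_coe_le_norm x

/-- The functional `u ↦ ∫ u f dx` on `C₀(ℝ)` given by `f ∈ B¹_σ`. -/
def pairC0 {σ : ℝ} (f : B σ) : C₀(ℝ, ℂ) →ₗ[ℂ] ℂ where
  toFun u := ∫ x, u x * toFun f x
  map_add' u v := by
    rw [← integral_add (integrable_C0_mul (integrable_toFun f) u)
      (integrable_C0_mul (integrable_toFun f) v)]
    simp [add_mul]
  map_smul' c u := by
    simp only [ZeroAtInftyContinuousMap.coe_smul, Pi.smul_apply, smul_eq_mul, RingHom.id_apply,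
      mul_assoc]
    rw [integral_const_mul]

lemma C0Sub_le_ker {σ : ℝ} (f : B σ) : C0Sub σ ≤ LinearMap.ker (pairC0 f) := by
  intro u hu
  rw [LinearMap.mem_ker]
  have h := hu _ (withDensity_mem_bandIdeal f)
  have hi : Integrable u (volume.withDensity fun x => ‖toFun f x‖ₑ) :=
    integrable_withDensity_of_bounded (integrable_toFun f) u.continuous ‖u.toBCF‖
      fun x => u.toBCF.norm_coe_le_norm x
  rw [cintegral_withDensity (integrable_toFun f) hi] at h
  exact h

/-- The duality `⟨f, [u]⟩ = ∫ u f dx` between `B¹_σ` and `C₀(ℝ) / C_{0,σ}(ℝ)`, through which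
`B¹_σ` is the dual space of `C₀(ℝ) / C_{0,σ}(ℝ)`. -/
def duality (σ : ℝ) : B σ →ₗ[ℂ] Predual σ →ₗ[ℂ] ℂ where
  toFun f := (C0Sub σ).liftQ (pairC0 f) (C0Sub_le_ker f)
  map_add' f g := by
    refine Submodule.linearMap_qext _ (LinearMap.ext fun u => ?_)
    change ∫ x, u x * toFun (f + g) x = (∫ x, u x * toFun f x) + ∫ x, u x * toFun g x
    rw [← integral_add (integrable_C0_mul (integrable_toFun f) u)
      (integrable_C0_mul (integrable_toFun g) u)]
    refine integral_congr_ae ?_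
    filter_upwards [Lp.coeFn_add (f : Lp ℂ 1 (volume : Measure ℝ)) g] with x hx
    simp only [toFun, Submodule.coe_add, hx, Pi.add_apply, mul_add]
  map_smul' c f := by
    refine Submodule.linearMap_qext _ (LinearMap.ext fun u => ?_)
    change ∫ x, u x * toFun (c • f) x = c * ∫ x, u x * toFun f x
    rw [← integral_const_mul]
    refine integral_congr_ae ?_
    filter_upwards [Lp.coeFn_smul c (f : Lp ℂ 1 (volume : Measure ℝ))] with x hx
    simp only [toFun, Submodule.coe_smul, hx, Pi.smul_apply, smul_eq_mul]
    ring

/-- The weak* topology of `B¹_σ`: the coarsest topology for which all `f ↦ ⟨f, q⟩` with `q` in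
the predual are continuous. -/
abbrev weakStarTopology (σ : ℝ) : TopologicalSpace (B σ) :=
  TopologicalSpace.induced (fun f q => duality σ f q) Pi.topologicalSpace

/-- The functional `Φ` is continuous for the weak* topology of `B¹_σ`. -/
def IsWeakStarContinuous {σ : ℝ} (Φ : StrongDual ℂ (B σ)) : Prop :=
  @Continuous (B σ) ℂ (weakStarTopology σ) inferInstance (fun f => Φ f)

/-! ### Exposed points of the unit ball -/

/-- `Φ` is an exposing functional for `f`: `Φ(f) = ‖Φ‖ = 1` and `Re Φ(g) < 1` for all `g ≠ f`
in the closed unit ball. -/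
def IsExposingFunctional {σ : ℝ} (Φ : StrongDual ℂ (B σ)) (f : B σ) : Prop :=
  Φ f = 1 ∧ ‖Φ‖ = 1 ∧ ∀ g ∈ D σ, g ≠ f → (Φ g).re < 1

/-- `exp D(B¹_σ)`: the exposed points. -/
def exposed (σ : ℝ) : Set (B σ) :=
  {f | f ∈ D σ ∧ ∃ Φ : StrongDual ℂ (B σ), IsExposingFunctional Φ f}

/-- `exps D(B¹_σ)`: the strongly exposed points. -/
def stronglyExposed (σ : ℝ) : Set (B σ) :=
  {f | f ∈ D σ ∧ ∃ Φ : StrongDual ℂ (B σ), IsExposingFunctional Φ f ∧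
    ∀ F : ℕ → B σ, (∀ n, F n ∈ D σ) → Tendsto (fun n => Φ (F n)) atTop (𝓝 1) →
      Tendsto F atTop (𝓝 f)}

/-- `exp* D(B¹_σ)`: the weak* exposed points, that is, the exposed points with a weak* continuous
exposing functional. -/
def weakStarExposed (σ : ℝ) : Set (B σ) :=
  {f | f ∈ D σ ∧ ∃ Φ : StrongDual ℂ (B σ), IsExposingFunctional Φ f ∧ IsWeakStarContinuous Φ}

/-- `exps* D(B¹_σ)`: the weak* strongly exposed points, that is, the points that are both weak*
exposed and strongly exposed. -/
def weakStarStronglyExposed (σ : ℝ) : Set (B σ) :=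
  weakStarExposed σ ∩ stronglyExposed σ

end BernsteinSpace

end

namespace BernsteinSpace

open scoped FourierTransform ContDiff

/-! By Fourier inversion each member of the unit ball has a representative that is bounded and
Lipschitz with constants depending only on σ. Hence every sequence in the ball has a subsequence
converging both almost everywhere and weak* to a member of the ball (`exists_subseq_tendsto_ae`).
The delicate point is that the limit is still band-limited: exponentials are not in C₀(ℝ), so they
are first damped by a sinc factor (`fourierL1_eq_zero_of_tendsto`).

A weak* continuous Φ exposing f is integration against some u ∈ C₀(ℝ) (`exists_eq_pairC0`). If
Φ(f_n) → 1, any such subsequential limit g has Φ(g) = 1, so g = f. Moreover |Φ(f_n)| ≤ ‖f_n‖ ≤ 1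
forces ‖f_n‖ → 1 = ‖f‖, so no mass is lost, and almost everywhere convergence improves to
convergence in L¹ (`tendsto_integral_norm_sub`). Thus the same Φ exposes f strongly. -/

/-! ### Fourier inversion for integrable functions -/

lemma fourierL1_eq_fourier (f : ℝ → ℂ) (t : ℝ) :
    fourierL1 f t = 𝓕 f (t / (2 * Real.pi)) := by
  rw [Real.fourier_eq', fourierL1]
  refine integral_congr_ae (Eventually.of_forall fun x => ?_)
  have : (-(t * x) : ℝ) = -2 * Real.pi * inner ℝ x (t / (2 * Real.pi)) := by
    have := Real.pi_ne_zero
    simp only [RCLike.inner_apply, conj_trivial]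
    field_simp
  simp only [smul_eq_mul, ← this]
  push_cast
  rfl

lemma integral_fourier_mul_eq {f g : ℝ → ℂ} (hf : Integrable f) (hg : Integrable g) :
    ∫ ξ, 𝓕 f ξ * g ξ = ∫ x, f x * 𝓕 g x := by
  simpa using! VectorFourier.integral_fourierIntegral_smul_eq_flip (L := innerₗ ℝ)
    Real.continuous_fourierChar continuous_inner hf hg

lemma integral_fourierInv_mul_eq {f g : ℝ → ℂ} (hf : Integrable f) (hg : Integrable g) :
    ∫ ξ, 𝓕⁻ f ξ * g ξ = ∫ x, f x * 𝓕⁻ g x := by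
  have h := integral_fourier_mul_eq hf.comp_neg hg
  rw [← Real.fourierInv_eq_fourier_comp_neg] at h
  rw [h, ← integral_neg_eq_self]
  simp [Real.fourierInv_eq_fourier_neg]

lemma continuous_fourier {f : ℝ → ℂ} (hf : Integrable f) : Continuous (𝓕 f) :=
  VectorFourier.fourierIntegral_continuous Real.continuous_fourierChar continuous_inner hf

lemma continuous_fourierInv {f : ℝ → ℂ} (hf : Integrable f) : Continuous (𝓕⁻ f) := by
  rw [Real.fourierInv_eq_fourier_comp_neg]
  exact continuous_fourier hf.comp_neg

/-- Fourier inversion almost everywhere. -/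
lemma fourierInv_fourier_ae_eq {f : ℝ → ℂ} (hf : Integrable f) (h'f : Integrable (𝓕 f)) :
    f =ᵐ[volume] 𝓕⁻ (𝓕 f) := by
  -- Both sides are tested against smooth compactly supported functions. Such a G is the transform
  -- of the Schwartz function H, so moving transforms across the integral twice needs only the
  -- integrability of f and of its transform.
  refine ae_eq_of_integral_contDiff_smul_eq hf.locallyIntegrable
    (continuous_fourierInv h'f).locallyIntegrable fun g hg hgc => ?_
  have h1 : HasCompactSupport fun x => (g x : ℂ) := hgc.comp_left Complex.ofReal_zero
  have h2 : ContDiff ℝ ∞ fun x => (g x : ℂ) := Complex.ofRealCLM.contDiff.comp hg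
  set G : SchwartzMap ℝ ℂ := h1.toSchwartzMap h2 with hG
  have hGx : ∀ x, G x = (g x : ℂ) := fun x => rfl
  simp_rw [Complex.real_smul, ← hGx]
  set H : SchwartzMap ℝ ℂ := 𝓕⁻ G with hH
  have e1 : ∀ x, 𝓕 (⇑H) x = G x := fun x => by
    rw [← SchwartzMap.fourier_coe, hH, FourierTransform.fourier_fourierInv_eq]
  have e2 : (⇑H : ℝ → ℂ) = 𝓕⁻ (⇑G) := SchwartzMap.fourierInv_coe G
  calc ∫ x, G x * f x = ∫ x, 𝓕 (⇑H) x * f x := by simp_rw [e1]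
    _ = ∫ x, H x * 𝓕 f x := integral_fourier_mul_eq H.integrable hf
    _ = ∫ x, 𝓕⁻ (⇑G) x * 𝓕 f x := by rw [e2]
    _ = ∫ x, G x * 𝓕⁻ (𝓕 f) x := integral_fourierInv_mul_eq G.integrable h'f

lemma norm_fourier_le (f : ℝ → ℂ) (w : ℝ) : ‖𝓕 f w‖ ≤ ∫ x, ‖f x‖ :=
  VectorFourier.norm_fourierIntegral_le_integral_norm _ _ _ _ _

/-! ### Uniform bounds for band-limited functions -/

section BandLimited

variable {f : ℝ → ℂ} {a : ℝ}

lemma norm_fourier_le_indicator (hfa : ∀ w, w ∉ Set.Icc (-a) a → 𝓕 f w = 0) (w : ℝ) :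
    ‖𝓕 f w‖ ≤ (Set.Icc (-a) a).indicator (fun _ => ∫ x, ‖f x‖) w := by
  by_cases hw : w ∈ Set.Icc (-a) a
  · rw [Set.indicator_of_mem hw]; exact norm_fourier_le f w
  · rw [Set.indicator_of_notMem hw, hfa w hw, norm_zero]

lemma integrable_indicator_const_Icc (a c : ℝ) :
    Integrable ((Set.Icc (-a) a).indicator fun _ : ℝ => c) :=
  (integrable_indicator_iff measurableSet_Icc).2 (integrableOn_const (by simp))

lemma integral_indicator_const_Icc (ha : 0 ≤ a) (c : ℝ) :
    ∫ w, (Set.Icc (-a) a).indicator (fun _ : ℝ => c) w = 2 * a * c := by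
  rw [integral_indicator measurableSet_Icc, setIntegral_const, smul_eq_mul]
  simp only [Measure.real, Real.volume_Icc]
  rw [ENNReal.toReal_ofReal (by linarith)]
  ring

lemma integrable_fourier (hf : Integrable f) (hfa : ∀ w, w ∉ Set.Icc (-a) a → 𝓕 f w = 0) :
    Integrable (𝓕 f) :=
  (integrable_indicator_const_Icc a (∫ x, ‖f x‖)).mono'
    (continuous_fourier hf).aestronglyMeasurable
    (Eventually.of_forall (norm_fourier_le_indicator hfa))

lemma norm_fourierInv_fourier_le (ha : 0 ≤ a)
    (hfa : ∀ w, w ∉ Set.Icc (-a) a → 𝓕 f w = 0) (x : ℝ) :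
    ‖𝓕⁻ (𝓕 f) x‖ ≤ 2 * a * ∫ x, ‖f x‖ := by
  rw [← integral_indicator_const_Icc ha, Real.fourierInv_eq]
  refine norm_integral_le_of_norm_le (integrable_indicator_const_Icc a _)
    (Eventually.of_forall fun w => ?_)
  rw [Circle.norm_smul]
  exact norm_fourier_le_indicator hfa w

/-- The Bernstein-type Lipschitz bound for band-limited functions. -/
lemma dist_fourierInv_fourier_le (ha : 0 ≤ a) (hf : Integrable f)
    (hfa : ∀ w, w ∉ Set.Icc (-a) a → 𝓕 f w = 0) (x y : ℝ) :
    dist (𝓕⁻ (𝓕 f) x) (𝓕⁻ (𝓕 f) y) ≤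
      2 * a * (2 * Real.pi * a * (∫ x, ‖f x‖)) * dist x y := by
  have hi := integrable_fourier hf hfa
  have hI : ∀ z : ℝ, Integrable fun w : ℝ =>
      Complex.exp (((2 * Real.pi * inner ℝ w z : ℝ) : ℂ) * Complex.I) • 𝓕 f w := fun z => by
    refine integrable_bounded_mul hi (by fun_prop) 1 fun w => ?_
    rw [Complex.norm_exp_ofReal_mul_I]
  rw [dist_eq_norm, Real.fourierInv_eq', Real.fourierInv_eq', ← integral_sub (hI x) (hI y),
    show 2 * a * (2 * Real.pi * a * (∫ x, ‖f x‖)) * dist x y =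
      2 * a * (2 * Real.pi * a * (∫ x, ‖f x‖) * dist x y) by ring,
    ← integral_indicator_const_Icc ha]
  refine norm_integral_le_of_norm_le (integrable_indicator_const_Icc a _)
    (Eventually.of_forall fun w => ?_)
  by_cases hw : w ∈ Set.Icc (-a) a
  · rw [Set.indicator_of_mem hw, ← sub_smul, norm_smul]
    -- Factoring out the phase at y leaves |exp(iθ) - 1| ≤ |θ| with θ = 2πw(x - y) and |w| ≤ a.
    have h1 : Complex.exp (((2 * Real.pi * inner ℝ w x : ℝ) : ℂ) * Complex.I) -
        Complex.exp (((2 * Real.pi * inner ℝ w y : ℝ) : ℂ) * Complex.I) =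
        Complex.exp (((2 * Real.pi * inner ℝ w y : ℝ) : ℂ) * Complex.I) *
          (Complex.exp (Complex.I * ((2 * Real.pi * (w * (x - y)) : ℝ) : ℂ)) - 1) := by
      rw [mul_sub, ← Complex.exp_add, mul_one]
      congr 2
      simp only [RCLike.inner_apply, conj_trivial]
      push_cast
      ring
    have h2 : ‖(2 * Real.pi * (w * (x - y)) : ℝ)‖ ≤ 2 * Real.pi * a * dist x y := by
      rw [Real.norm_eq_abs, abs_mul (2 * Real.pi), abs_mul w, abs_of_pos Real.two_pi_pos, Real.dist_eq, ← mul_assoc]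
      have := abs_le.2 hw
      gcongr
    rw [h1, norm_mul, Complex.norm_exp_ofReal_mul_I, one_mul]
    calc _ ≤ (2 * Real.pi * a * dist x y) * ∫ x, ‖f x‖ := by
          gcongr
          · exact Real.norm_exp_I_mul_ofReal_sub_one_le.trans h2
          · exact norm_fourier_le f w
      _ = _ := by ring
  · rw [Set.indicator_of_notMem hw, hfa w hw]
    simp

end BandLimited

/-! ### Pointwise compactness -/

/-- A uniformly bounded, uniformly Lipschitz sequence of functions on the line has a pointwise
convergent subsequence. -/
lemma exists_subseq_tendsto_of_lipschitz {G : ℕ → ℝ → ℂ} {M K : ℝ}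
    (hM : ∀ n x, ‖G n x‖ ≤ M) (hK : ∀ n x y, dist (G n x) (G n y) ≤ K * dist x y) :
    ∃ g : ℝ → ℂ, ∃ φ : ℕ → ℕ, StrictMono φ ∧
      ∀ x, Tendsto (fun n => G (φ n) x) atTop (𝓝 (g x)) := by
  -- Sequential compactness of a countable product of discs replaces the diagonal argument and gives
  -- convergence at all rationals.
  have hc : IsCompact (Set.univ.pi fun _ : ℚ => Metric.closedBall (0 : ℂ) M) :=
    isCompact_univ_pi fun _ => isCompact_closedBall _ _
  obtain ⟨h, -, φ, hφ, hlim⟩ := hc.tendsto_subseq (x := fun n (q : ℚ) => G n q)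
    fun n q _ => by simpa using hM n q
  rw [tendsto_pi_nhds] at hlim
  have hcau : ∀ x, CauchySeq fun n => G (φ n) x := fun x => by
    rw [Metric.cauchySeq_iff]
    intro ε hε
    -- The sign of K is not assumed; |K| + 1 is a positive majorant. The two Lipschitz errors cost
    -- ε/4 each and the rational point ε/2.
    have hK' : 0 < |K| + 1 := by positivity
    obtain ⟨q, hq⟩ := Rat.denseRange_cast (𝕜 := ℝ) |>.exists_dist_lt x
      (show 0 < ε / (4 * (|K| + 1)) by positivity)
    obtain ⟨N, hN⟩ := Metric.cauchySeq_iff.1 (hlim q).cauchySeq (ε / 2) (by positivity)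
    refine ⟨N, fun m hm n hn => ?_⟩
    have hb : ∀ k, dist (G k x) (G k q) ≤ ε / 4 := fun k => by
      refine (hK k x q).trans ?_
      calc K * dist x q ≤ (|K| + 1) * (ε / (4 * (|K| + 1))) := by
            have := le_abs_self K
            gcongr
            linarith
        _ = ε / 4 := by field_simp
    have h1 := dist_triangle4 (G (φ m) x) (G (φ m) q) (G (φ n) q) (G (φ n) x)
    have h2 := hb (φ m)
    have h3 := hb (φ n)
    rw [dist_comm] at h3
    have h4 := hN m hm n hn
    simp only [Function.comp_apply] at h4
    linarith
  choose g hg using fun x => cauchySeq_tendsto_of_complete (hcau x)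
  exact ⟨g, φ, hφ, hg⟩

/-! ### Damping by sinc -/

/-- Exhibits sinc as the transform of the uniform distribution on [-1, 1], so multiplication by
sinc(εx) spreads a spectrum by at most ε. -/
lemma sinc_eq_integral (r : ℝ) :
    (Real.sinc r : ℂ) = 2⁻¹ * ∫ s in (-1 : ℝ)..1, Complex.exp (((r * s : ℝ) : ℂ) * Complex.I) := by
  by_cases hr : r = 0
  · simp [hr]
    norm_num
  · rw [intervalIntegral.integral_comp_mul_left (fun t : ℝ => Complex.exp ((t : ℂ) * Complex.I)) hr,
      mul_neg, mul_one, integral_exp_mul_I_eq_sinc, Complex.real_smul]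
    have : (r : ℂ) ≠ 0 := by exact_mod_cast hr
    push_cast
    field_simp

lemma tendsto_sinc_cocompact : Tendsto Real.sinc (cocompact ℝ) (𝓝 0) := by
  refine squeeze_zero_norm' ?_ (tendsto_norm_cocompact_atTop (E := ℝ)).inv_tendsto_atTop
  have : ∀ᶠ x : ℝ in cocompact ℝ, x ∈ ({0} : Set ℝ)ᶜ := isCompact_singleton.compl_mem_cocompact
  filter_upwards [this] with x hx
  rw [Real.sinc_of_ne_zero hx, norm_div, Pi.inv_apply, div_eq_mul_inv]
  exact mul_le_of_le_one_left (by positivity) (Real.abs_sin_le_one x)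

/-- Fourier transforms after multiplication with `sinc (ε x)` are averages of Fourier
transforms. -/
lemma integral_exp_sinc_mul {f : ℝ → ℂ} (hf : Integrable f) (t ε : ℝ) :
    ∫ x : ℝ, Complex.exp (-((t * x : ℝ) : ℂ) * Complex.I) * (Real.sinc (ε * x) : ℂ) * f x =
      2⁻¹ * ∫ s in (-1 : ℝ)..1, fourierL1 f (t - ε * s) := by
  have hpt : ∀ x : ℝ,
      Complex.exp (-((t * x : ℝ) : ℂ) * Complex.I) * (Real.sinc (ε * x) : ℂ) * f x =
      2⁻¹ * ∫ s in (-1 : ℝ)..1,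
        Complex.exp (-(((t - ε * s) * x : ℝ) : ℂ) * Complex.I) * f x := fun x => by
    rw [sinc_eq_integral, intervalIntegral.integral_mul_const]
    have : ∀ s : ℝ, Complex.exp (-(((t - ε * s) * x : ℝ) : ℂ) * Complex.I) =
        Complex.exp (-((t * x : ℝ) : ℂ) * Complex.I) *
          Complex.exp (((ε * x * s : ℝ) : ℂ) * Complex.I) := fun s => by
      rw [← Complex.exp_add]
      congr 1
      push_cast
      ring
    simp_rw [this, intervalIntegral.integral_const_mul]
    ring
  simp_rw [hpt, integral_const_mul, intervalIntegral.integral_of_le (show (-1 : ℝ) ≤ 1 by norm_num)]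
  congr 1
  refine integral_integral_swap ?_
  have h1 : Integrable (fun p : ℝ × ℝ => f p.1)
      ((volume : Measure ℝ).prod (volume.restrict (Set.Ioc (-1 : ℝ) 1))) := hf.comp_fst _
  refine h1.bdd_mul (c := 1) (Continuous.aestronglyMeasurable (by fun_prop))
    (Eventually.of_forall fun p => (norm_expKernel _ _).le)

/-! ### From almost everywhere convergence to convergence of integrals and norms -/

/-- Bounded almost everywhere convergence of `f n` in the unit ball of `L¹` gives convergence of
the integrals against functions vanishing at infinity. -/
lemma tendsto_integral_mul_of_vanishing {f : ℕ → ℝ → ℂ} {g u : ℝ → ℂ} {M C : ℝ}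
    (hf : ∀ n, Integrable (f n)) (hf1 : ∀ n, ∫ x, ‖f n x‖ ≤ 1)
    (hfM : ∀ n, ∀ᵐ x, ‖f n x‖ ≤ M) (hg : Integrable g) (hg1 : ∫ x, ‖g x‖ ≤ 1)
    (hlim : ∀ᵐ x, Tendsto (fun n => f n x) atTop (𝓝 (g x)))
    (hu : Continuous u) (huC : ∀ x, ‖u x‖ ≤ C) (hu0 : Tendsto u (cocompact ℝ) (𝓝 0)) :
    Tendsto (fun n => ∫ x, u x * f n x) atTop (𝓝 (∫ x, u x * g x)) := by
  rw [Metric.tendsto_atTop]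
  intro ε hε
  have h0 : ∀ᶠ x in cocompact ℝ, ‖u x‖ < ε / 4 :=
    (tendsto_zero_iff_norm_tendsto_zero.1 hu0).eventually_lt_const (by positivity)
  obtain ⟨s, hs, hsu⟩ := mem_cocompact.1 h0
  have hmeas : MeasurableSet s := hs.measurableSet
  have hfu : ∀ n, Integrable fun x => u x * f n x := fun n =>
    integrable_bounded_mul (hf n) hu C huC
  have hgu : Integrable fun x => u x * g x := integrable_bounded_mul hg hu C huC
  -- Off s the weight u is below ε/4 and h has mass at most 1. The two tails and the local
  -- difference then add up to less than ε.
  have htail : ∀ h : ℝ → ℂ, Integrable h → ∫ x, ‖h x‖ ≤ 1 →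
      ‖∫ x in sᶜ, u x * h x‖ ≤ ε / 4 := fun h hh hh1 => by
    calc ‖∫ x in sᶜ, u x * h x‖ ≤ ∫ x in sᶜ, ε / 4 * ‖h x‖ := by
          refine norm_integral_le_of_norm_le (hh.norm.const_mul _).integrableOn ?_
          filter_upwards [ae_restrict_mem hmeas.compl] with x hx
          rw [norm_mul]
          gcongr
          exact (hsu hx).le
      _ ≤ ∫ x, ε / 4 * ‖h x‖ := setIntegral_le_integral (hh.norm.const_mul _)
          (Eventually.of_forall fun x => by positivity)
      _ ≤ ε / 4 := by
          rw [integral_const_mul]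
          exact mul_le_of_le_one_right (by positivity) hh1
  have hlocal : Tendsto (fun n => ∫ x in s, u x * f n x) atTop (𝓝 (∫ x in s, u x * g x)) := by
    refine tendsto_integral_of_dominated_convergence (fun _ => C * M)
      (fun n => (hfu n).integrableOn.aestronglyMeasurable)
      (integrableOn_const hs.measure_lt_top.ne) (fun n => ?_) ?_
    · filter_upwards [ae_restrict_of_ae (hfM n)] with x hx
      rw [norm_mul]
      exact mul_le_mul (huC x) hx (norm_nonneg _) ((norm_nonneg _).trans (huC x))
    · filter_upwards [ae_restrict_of_ae hlim] with x hx using hx.const_mul _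
  obtain ⟨N, hN⟩ := Metric.tendsto_atTop.1 hlocal (ε / 4) (by positivity)
  refine ⟨N, fun n hn => ?_⟩
  have h1 := hN n hn
  have h2 := htail _ (hf n) (hf1 n)
  have h3 := htail _ hg hg1
  rw [dist_eq_norm] at h1 ⊢
  rw [← integral_add_compl hmeas (hfu n), ← integral_add_compl hmeas hgu,
    add_sub_add_comm]
  have h4 := norm_add_le ((∫ x in s, u x * f n x) - ∫ x in s, u x * g x)
    ((∫ x in sᶜ, u x * f n x) - ∫ x in sᶜ, u x * g x)
  have h5 := norm_sub_le (∫ x in sᶜ, u x * f n x) (∫ x in sᶜ, u x * g x)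
  linarith

/-- Almost everywhere convergence together with convergence of the norms gives convergence in
mean. -/
lemma tendsto_integral_norm_sub {α : Type*} [MeasurableSpace α] {μ : Measure α}
    {f : ℕ → α → ℂ} {g : α → ℂ}
    (hf : ∀ n, Integrable (f n) μ) (hg : Integrable g μ)
    (hlim : ∀ᵐ x ∂μ, Tendsto (fun n => f n x) atTop (𝓝 (g x)))
    (hnorm : Tendsto (fun n => ∫ x, ‖f n x‖ ∂μ) atTop (𝓝 (∫ x, ‖g x‖ ∂μ))) :
    Tendsto (fun n => ∫ x, ‖f n x - g x‖ ∂μ) atTop (𝓝 0) := by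
  -- The difference |f_n| - |f_n - g| is dominated by |g|, although neither term need be dominated
  -- by itself.
  have h1 : Tendsto (fun n => ∫ x, (‖f n x‖ - ‖f n x - g x‖) ∂μ) atTop (𝓝 (∫ x, ‖g x‖ ∂μ)) := by
    refine tendsto_integral_of_dominated_convergence (fun x => ‖g x‖)
      (fun n => ((hf n).norm.sub ((hf n).sub hg).norm).aestronglyMeasurable) hg.norm
      (fun n => Eventually.of_forall fun x => ?_) ?_
    · simpa using abs_norm_sub_norm_le (f n x) (f n x - g x)
    · filter_upwards [hlim] with x hx
      simpa using hx.norm.sub (hx.sub_const (g x)).norm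
  have h2 := hnorm.sub h1
  rw [sub_self] at h2
  refine h2.congr fun n => ?_
  have h3 : Integrable (fun x => ‖f n x - g x‖) μ := ((hf n).sub hg).norm
  rw [integral_sub (hf n).norm h3, sub_sub_cancel]

/-! ### Sequential compactness of the unit ball -/

lemma norm_eq_integral_toFun {σ : ℝ} (f : B σ) : ‖f‖ = ∫ x, ‖toFun f x‖ := by
  rw [Submodule.coe_norm, L1.norm_eq_integral_norm]
  rfl

lemma mem_D_iff {σ : ℝ} {f : B σ} : f ∈ D σ ↔ ∫ x, ‖toFun f x‖ ≤ 1 := by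
  rw [D, mem_closedBall_zero_iff, norm_eq_integral_toFun]

/-- The band edge becomes σ/(2π) because `𝓕` uses the kernel exp(-2πiwx). -/
lemma fourier_toFun_eq_zero {σ : ℝ} (f : B σ) (w : ℝ)
    (hw : w ∉ Set.Icc (-(σ / (2 * Real.pi))) (σ / (2 * Real.pi))) : 𝓕 (toFun f) w = 0 := by
  have hpi := Real.two_pi_pos
  have h := f.2 (2 * Real.pi * w) fun hm => hw ?_
  · rwa [fourierL1_eq_fourier, mul_div_cancel_left₀ _ hpi.ne'] at h
  · rw [Set.mem_Icc, ← neg_div, div_le_iff₀' hpi, le_div_iff₀' hpi]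
    exact hm

lemma fourierL1_congr_ae {f g : ℝ → ℂ} (h : f =ᵐ[volume] g) (t : ℝ) :
    fourierL1 f t = fourierL1 g t :=
  integral_congr_ae (by filter_upwards [h] with x hx; rw [hx])

/-- The vanishing of the Fourier transform outside `[-σ, σ]` passes to limits against functions
vanishing at infinity. -/
lemma fourierL1_eq_zero_of_tendsto {σ : ℝ} {F : ℕ → B σ} {g : ℝ → ℂ} (hg : Integrable g)
    (h : ∀ (u : ℝ → ℂ) (C : ℝ), Continuous u → (∀ x, ‖u x‖ ≤ C) → Tendsto u (cocompact ℝ) (𝓝 0) →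
      Tendsto (fun n => ∫ x, u x * toFun (F n) x) atTop (𝓝 (∫ x, u x * g x)))
    {t : ℝ} (ht : t ∉ Set.Icc (-σ) σ) : fourierL1 g t = 0 := by
  have ht' : σ < |t| := by
    by_contra hle
    exact ht (abs_le.1 (not_lt.1 hle))
  -- The damped exponential vanishes at infinity, so it is an admissible test function. Its
  -- integrals against `F n` average the transform over t - εs with |s| ≤ 1, and these stay outside
  -- [-σ, σ] when ε < |t| - σ.
  have hzero : ∀ ε : ℝ, 0 < ε → ε < |t| - σ →
      ∫ x : ℝ, Complex.exp (-((t * x : ℝ) : ℂ) * Complex.I) * (Real.sinc (ε * x) : ℂ) * g x = 0 := by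
    intro ε hε hεt
    have hbd : ∀ x : ℝ,
        ‖Complex.exp (-((t * x : ℝ) : ℂ) * Complex.I) * (Real.sinc (ε * x) : ℂ)‖ ≤
          |Real.sinc (ε * x)| := fun x => by
      rw [norm_mul, norm_expKernel, one_mul, Complex.norm_real, Real.norm_eq_abs]
    have hlim := h (fun x => Complex.exp (-((t * x : ℝ) : ℂ) * Complex.I) *
      (Real.sinc (ε * x) : ℂ)) 1
      ((continuous_expKernel t).mul (Complex.continuous_ofReal.comp
        (Real.continuous_sinc.comp (continuous_const.mul continuous_id))))
      (fun x => (hbd x).trans (Real.abs_sinc_le_one _)) (by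
        refine squeeze_zero_norm hbd ?_
        have := tendsto_sinc_cocompact.comp
          (Homeomorph.mulLeft₀ ε hε.ne').isClosedEmbedding.tendsto_cocompact
        simpa using this.abs)
    refine tendsto_nhds_unique hlim ?_
    refine tendsto_const_nhds.congr fun n => ?_
    rw [integral_exp_sinc_mul (integrable_toFun _)]
    have : ∀ s ∈ Set.uIcc (-1 : ℝ) 1, fourierL1 (toFun (F n)) (t - ε * s) = 0 := fun s hs => by
      rw [Set.uIcc_of_le (by norm_num), Set.mem_Icc, ← abs_le] at hs
      refine (F n).2 _ fun hm => ?_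
      have h1 := abs_le.2 hm
      have h2 := abs_sub_abs_le_abs_sub t (ε * s)
      have h3 : |ε * s| ≤ ε := by
        rw [abs_mul, abs_of_pos hε]
        exact mul_le_of_le_one_right hε.le hs
      linarith
    rw [intervalIntegral.integral_congr (g := fun _ => 0) this]
    simp
  -- As ε → 0 the damping tends to sinc 0 = 1, which recovers the transform of g at t.
  have hconv : Tendsto (fun ε : ℝ => ∫ x : ℝ,
      Complex.exp (-((t * x : ℝ) : ℂ) * Complex.I) * (Real.sinc (ε * x) : ℂ) * g x)
      (𝓝[>] 0) (𝓝 (fourierL1 g t)) := by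
    refine tendsto_integral_filter_of_dominated_convergence (fun x => ‖g x‖) ?_ ?_ hg.norm ?_
    · refine Eventually.of_forall fun ε => ?_
      refine AEStronglyMeasurable.mul (Continuous.aestronglyMeasurable ?_) hg.aestronglyMeasurable
      exact (continuous_expKernel t).mul (Complex.continuous_ofReal.comp
        (Real.continuous_sinc.comp (continuous_const.mul continuous_id)))
    · refine Eventually.of_forall fun ε => Eventually.of_forall fun x => ?_
      rw [norm_mul, norm_mul, norm_expKernel, one_mul, Complex.norm_real]
      exact mul_le_of_le_one_left (norm_nonneg _) (Real.abs_sinc_le_one _)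
    · refine Eventually.of_forall fun x => ?_
      have hc : Continuous fun ε : ℝ =>
          Complex.exp (-((t * x : ℝ) : ℂ) * Complex.I) * (Real.sinc (ε * x) : ℂ) * g x :=
        (continuous_const.mul (Complex.continuous_ofReal.comp
          (Real.continuous_sinc.comp (continuous_id.mul continuous_const)))).mul continuous_const
      have := (hc.tendsto 0).mono_left (nhdsWithin_le_nhds (s := Set.Ioi 0))
      simpa using this
  refine tendsto_nhds_unique hconv (tendsto_const_nhds.congr' ?_)
  filter_upwards [Ioo_mem_nhdsGT (show (0 : ℝ) < |t| - σ by linarith)] with ε hε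
  exact (hzero ε hε.1 hε.2).symm

/-- Sequential weak* compactness of the unit ball, together with almost everywhere convergence. -/
lemma exists_subseq_tendsto_ae {σ : ℝ} (hσ : 0 ≤ σ) {F : ℕ → B σ} (hF : ∀ n, F n ∈ D σ) :
    ∃ g ∈ D σ, ∃ φ : ℕ → ℕ, StrictMono φ ∧
      (∀ᵐ x, Tendsto (fun n => toFun (F (φ n)) x) atTop (𝓝 (toFun g x))) ∧
      ∀ u : C₀(ℝ, ℂ), Tendsto (fun n => pairC0 (F (φ n)) u) atTop (𝓝 (pairC0 g u)) := by
  have hpi := Real.pi_pos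
  set a := σ / (2 * Real.pi) with ha
  have ha0 : 0 ≤ a := by positivity
  have hF1 : ∀ n, ∫ x, ‖toFun (F n) x‖ ≤ 1 := fun n => mem_D_iff.1 (hF n)
  have hinv : ∀ n, toFun (F n) =ᵐ[volume] 𝓕⁻ (𝓕 (toFun (F n))) := fun n =>
    fourierInv_fourier_ae_eq (integrable_toFun _)
      (integrable_fourier (integrable_toFun _) (fourier_toFun_eq_zero _))
  have hbd : ∀ n x, ‖𝓕⁻ (𝓕 (toFun (F n))) x‖ ≤ 2 * a := fun n x =>
    (norm_fourierInv_fourier_le ha0 (fourier_toFun_eq_zero _) x).trans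
      (mul_le_of_le_one_right (by positivity) (hF1 n))
  obtain ⟨g, φ, hφ, hg⟩ := exists_subseq_tendsto_of_lipschitz
    (G := fun n => 𝓕⁻ (𝓕 (toFun (F n)))) (K := 2 * a * (2 * Real.pi * a)) hbd
    fun n x y => by
      refine (dist_fourierInv_fourier_le ha0 (integrable_toFun (F n))
        (fourier_toFun_eq_zero _) x y).trans ?_
      have := mul_le_of_le_one_right (by positivity : 0 ≤ 2 * Real.pi * a) (hF1 n)
      gcongr
  have hae : ∀ᵐ x, Tendsto (fun n => toFun (F (φ n)) x) atTop (𝓝 (g x)) := by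
    filter_upwards [ae_all_iff.2 hinv] with x hx
    simpa only [hx] using hg x
  have hgm : AEStronglyMeasurable g volume :=
    aestronglyMeasurable_of_tendsto_ae atTop
      (fun n => (integrable_toFun (F (φ n))).aestronglyMeasurable) hae
  -- Fatou's lemma: the L¹ norm is lower semicontinuous under almost everywhere convergence.
  have hgn : eLpNorm g 1 volume ≤ 1 := by
    refine Lp.eLpNorm_le_of_ae_tendsto (u := atTop) (Eventually.of_forall fun n => ?_)
      (fun n => (integrable_toFun (F (φ n))).aestronglyMeasurable) hae
    rw [eLpNorm_one_eq_lintegral_enorm, ← ofReal_integral_norm_eq_lintegral_enorm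
      (integrable_toFun _)]
    exact ENNReal.ofReal_le_one.2 (hF1 _)
  have hgL : MemLp g 1 volume := ⟨hgm, hgn.trans_lt ENNReal.one_lt_top⟩
  have hgi : Integrable g := memLp_one_iff_integrable.1 hgL
  have hg1 : ∫ x, ‖g x‖ ≤ 1 := by
    rw [eLpNorm_one_eq_lintegral_enorm, ← ofReal_integral_norm_eq_lintegral_enorm hgi] at hgn
    exact ENNReal.ofReal_le_one.1 hgn
  have hweak : ∀ (u : ℝ → ℂ) (C : ℝ), Continuous u → (∀ x, ‖u x‖ ≤ C) →
      Tendsto u (cocompact ℝ) (𝓝 0) →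
      Tendsto (fun n => ∫ x, u x * toFun (F (φ n)) x) atTop (𝓝 (∫ x, u x * g x)) :=
    fun u C hu huC hu0 => tendsto_integral_mul_of_vanishing (fun n => integrable_toFun _)
      (fun n => hF1 _) (fun n => by
        filter_upwards [hinv (φ n)] with x hx
        rw [hx]
        exact hbd _ x) hgi hg1 hae hu huC hu0
  have hco : (hgL.toLp g : ℝ → ℂ) =ᵐ[volume] g := hgL.coeFn_toLp
  let g' : B σ := ⟨hgL.toLp g, fun t ht => by
    rw [fourierL1_congr_ae hco]
    exact fourierL1_eq_zero_of_tendsto hgi hweak ht⟩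
  have hg' : toFun g' =ᵐ[volume] g := hco
  refine ⟨g', ?_, φ, hφ, ?_, fun u => ?_⟩
  · rw [mem_D_iff]
    refine le_of_eq_of_le (integral_congr_ae ?_) hg1
    filter_upwards [hg'] with x hx
    rw [hx]
  · filter_upwards [hae, hg'] with x hx hx'
    rwa [hx']
  · have e : pairC0 g' u = ∫ x, u x * g x := integral_congr_ae (by
      filter_upwards [hg'] with x hx
      rw [hx])
    rw [e]
    exact hweak u ‖u.toBCF‖ u.continuous (fun x => u.toBCF.norm_coe_le_norm x) u.zero_at_infty'

/-! ### Exposing functionals -/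

/-- A weak* continuous functional is the pairing with a function in `C₀(ℝ)`. -/
lemma exists_eq_pairC0 {σ : ℝ} {Φ : StrongDual ℂ (B σ)} (hΦ : IsWeakStarContinuous Φ) :
    ∃ u : C₀(ℝ, ℂ), ∀ f : B σ, Φ f = pairC0 f u := by
  -- The topology of `WeakBilin (duality σ)` is the weak* topology, so `hΦ` is its continuity proof.
  -- Functionals continuous for a weak topology of a pairing are evaluations at elements of the
  -- other space, and u is any representative of that class.
  let Ψ : StrongDual ℂ (WeakBilin (duality σ)) := { toLinearMap := Φ.toLinearMap, cont := hΦ }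
  obtain ⟨q, hq⟩ := LinearMap.dualEmbedding_surjective (duality σ) Ψ
  obtain ⟨u, rfl⟩ := Submodule.Quotient.mk_surjective _ q
  exact ⟨u, fun f => (DFunLike.congr_fun hq f).symm⟩

/-- A weak* continuous exposing functional exposes strongly. -/
lemma tendsto_of_isExposingFunctional {σ : ℝ} (hσ : 0 ≤ σ) {Φ : StrongDual ℂ (B σ)} {f : B σ}
    (hΦ : IsExposingFunctional Φ f) (hΦw : IsWeakStarContinuous Φ) {F : ℕ → B σ}
    (hF : ∀ n, F n ∈ D σ) (hlim : Tendsto (fun n => Φ (F n)) atTop (𝓝 1)) :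
    Tendsto F atTop (𝓝 f) := by
  obtain ⟨hf, hnorm, hexp⟩ := hΦ
  obtain ⟨u, hu⟩ := exists_eq_pairC0 hΦw
  have hle : ∀ g : B σ, ‖Φ g‖ ≤ ‖g‖ := fun g => by simpa [hnorm] using Φ.le_opNorm g
  -- It suffices that every subsequence has a further subsequence tending to f.
  refine tendsto_of_subseq_tendsto fun ns hns => ?_
  obtain ⟨g, hg, φ, hφ, hae, hw⟩ := exists_subseq_tendsto_ae hσ (F := fun n => F (ns n))
    fun n => hF _
  have hlim' : Tendsto (fun n => Φ (F (ns (φ n)))) atTop (𝓝 1) :=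
    hlim.comp (hns.comp hφ.tendsto_atTop)
  have hg1 : Φ g = 1 := by
    rw [hu]
    exact tendsto_nhds_unique (hw u) (by simpa only [hu] using hlim')
  obtain rfl : g = f := by
    by_contra hne
    have := hexp g hg hne
    rw [hg1] at this
    simp at this
  have hgn : ‖g‖ = 1 := le_antisymm (mem_closedBall_zero_iff.1 hg) (by simpa [hf] using hle g)
  -- The norms are squeezed between |Φ(F_n)| → 1 and 1.
  have hn : Tendsto (fun n => ‖F (ns (φ n))‖) atTop (𝓝 ‖g‖) := by
    rw [hgn]
    refine tendsto_of_tendsto_of_tendsto_of_le_of_le (by simpa using hlim'.norm)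
      tendsto_const_nhds (fun n => hle _) fun n => mem_closedBall_zero_iff.1 (hF _)
  refine ⟨φ, tendsto_iff_norm_sub_tendsto_zero.2 ?_⟩
  simp only [norm_eq_integral_toFun] at hn
  refine (tendsto_integral_norm_sub (fun n => integrable_toFun _) (integrable_toFun g) hae hn).congr
    fun n => ?_
  rw [norm_eq_integral_toFun]
  refine integral_congr_ae ?_
  filter_upwards [Lp.coeFn_sub (F (ns (φ n)) : Lp ℂ 1 (volume : Measure ℝ)) g] with x hx
  simp only [toFun, Submodule.coe_sub, hx, Pi.sub_apply]

end BernsteinSpace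

theorem theorem4p4 (σ : ℝ) (hσ : 0 < σ) :
    BernsteinSpace.weakStarExposed σ = BernsteinSpace.weakStarStronglyExposed σ := by
  refine Set.Subset.antisymm (fun f hf => ⟨hf, ?_⟩) Set.inter_subset_left
  obtain ⟨hfD, Φ, hΦ, hΦw⟩ := hf
  exact ⟨hfD, Φ, hΦ, fun F hF hlim =>
    BernsteinSpace.tendsto_of_isExposingFunctional hσ.le hΦ hΦw hF hlim⟩
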